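/- Deterministic cut-query algorithm for the unbalanced case. Let $G=(V,E)$ be a simple undirected graph on a known vertex set $V$ with $|V|=n$; the edge set is unknown and is accessible only through cut queries: a query is a set $S\subseteq V$, and its answer is $|\partial_G S|$, the number of edges with exactly one endpoint in $S$. A \emph{cut} is a pair $(C,V\setminus C)$ with $\emptyset\ne C\subsetneq V$, and its size is $|\partial_G C|$. For an integer $\tau\ge 0$, a set $R\subseteq V$ is \emph{$\tau$-separated} in $G$ if every cut $(C,V\setminus C)$ of size at most $\tau$ satisfies $C\cap R\neq\emptyset$ and $R\setminus C\ne\emptyset$. For $\phi>0$, a cut $(C,V\setminus C)$ of size at most $\tau$ is \emph{$\phi$-unbalanced} for $R$ if $\min\{|C\cap R|,|R\setminus C|\}\le (1/\phi)^3+1/\phi$. For all constants $c_1,c_2>0$ and $a,b\in\mathbb{N}$ there are constants $K$ and $k$ such that the following holds for every finite vertex set $V$, $n=|V|$, every integer $\tau\ge 0$ and every $R\subseteq V$ with $|R|\,\tau\le c_1\, n\log^{a} n$ (that is, $|R|\le\widetilde O(n/\tau)$). There is a deterministic adaptive algorithm (a decision tree that depends on $V,\tau,R$, but not on the graph) which makes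 at most $K\,n^{5/3}\log^{k} n$ cut queries on every simple graph $G$ on $V$, and which has the following property: whenever $R$ is $\tau$-separated in $G$ and, for some $\phi\ge c_2(1/\log n)^{b}$, $G$ has a cut of size at most $\tau$ that is $\phi$-unbalanced for $R$, the algorithm outputs a cut of $G$ of size at most $\tau$. -/

import Mathlib

/-- A deterministic algorithm in the cut-query model on the vertex set `V` with outputs in `β`,
as an adaptive decision tree: it either stops with an output, or it asks the oracle about a vertex
set `S` and continues in a way determined by the (integer) answer. Computation between queries is
not charged. The tree is fixed before the graph is, and the graph is accessible only through the
answers. -/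
inductive CutQueryAlgorithm (V : Type*) (β : Type*) where
  | output (b : β) : CutQueryAlgorithm V β
  | query (S : Finset V) (next : ℕ → CutQueryAlgorithm V β) : CutQueryAlgorithm V β

namespace CutQueryAlgorithm

/-- The output of the algorithm when the queries are answered by `oracle`. -/
def run {V β : Type*} (oracle : Finset V → ℕ) : CutQueryAlgorithm V β → β
  | output b => b
  | query S next => run oracle (next (oracle S))

/-- The number of queries that the algorithm makes when they are answered by `oracle`. -/
def numQueries {V β : Type*} (oracle : Finset V → ℕ) : CutQueryAlgorithm V β → ℕ
  | output _ => 0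
  | query S next => numQueries oracle (next (oracle S)) + 1

end CutQueryAlgorithm

/-- `cutSize G S` is the number of edges of `G` between `S` and its complement: every such edge is
counted once, as the pair (endpoint in `S`, endpoint outside `S`). As a function of `S` this is the
cut oracle of `G`. -/
noncomputable def cutSize {V : Type*} [Fintype V] [DecidableEq V] (G : SimpleGraph V)
    (S : Finset V) : ℕ :=
  open Classical in (G.interedges S Sᶜ).card

/-- `(C, V \ C)` is a cut: both of its sides are non-empty. -/
def IsCut {V : Type*} [Fintype V] [DecidableEq V] (C : Finset V) : Prop :=
  C.Nonempty ∧ Cᶜ.Nonempty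

/-- `R` is `c`-separated in `G`: it meets both sides of every cut of size at most `c`. -/
def IsSeparated {V : Type*} [Fintype V] [DecidableEq V] (G : SimpleGraph V) (c : ℕ)
    (R : Finset V) : Prop :=
  ∀ C : Finset V, IsCut C → cutSize G C ≤ c → (C ∩ R).Nonempty ∧ (R \ C).Nonempty

/-- The cut `(C, V \ C)` is `φ`-unbalanced for `R`. -/
def IsUnbalanced {V : Type*} [Fintype V] [DecidableEq V] (φ : ℝ) (R C : Finset V) : Prop :=
  ((min (C ∩ R).card (Cᶜ ∩ R).card : ℕ) : ℝ) ≤ (1 / φ) ^ 3 + 1 / φ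

/-! One side of an unbalanced cut meets R in at least one vertex, by separation, and in at most s =
polylog(n) vertices. Hash every vertex by evaluating the polynomial of its code bits at a point of
`ZMod p`, with p polylogarithmic, and keep the vertices of R that take one of two hash values. This
gives p^3 subsets of R, and one of them meets the small side in a single vertex and still meets the
other side (`exists_hashClass_isolating`).

For each subset, `solvable_isolatingCuts` looks for a small cut isolating one terminal. One minimum
cut per code bit splits V into cells. By submodularity an isolating cut can be shrunk into the cell
of its terminal. One more minimum cut, in which edges leaving a cell become sink capacity, then
treats all cells at once. So polylogarithmically many minimum cuts suffice.

A terminal needs capacity only τ + 1, so the total supply is Õ(n). Cut queries count neighbours in a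
set, so binary search finds a residual arc with O(log n) queries. Push-relabel with labels capped at
D = ⌈n^(2/3)⌉ takes O(nD + D · supply) searches. Afterwards every undelivered unit sits at label D,
and some two consecutive label classes span at most (n/D)^2 ≤ D pairs, so at most 2D units can still
be delivered (`IsLabelling.exists_cut`). Each augmentation needs at most 2n searches, and the total
is Õ(nD) = Õ(n^(5/3)). -/

set_option linter.unusedSectionVars false

/-! ### Composition of decision trees -/

namespace CutQueryAlgorithm

/-- Run one algorithm and continue with another that depends on its output. -/
def bind {V β γ : Type*} :
    CutQueryAlgorithm V β → (β → CutQueryAlgorithm V γ) → CutQueryAlgorithm V γ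
  | output b, k => k b
  | query S next, k => query S fun r => (next r).bind k

theorem run_bind {V β γ : Type*} (o : Finset V → ℕ) (A : CutQueryAlgorithm V β)
    (k : β → CutQueryAlgorithm V γ) : (A.bind k).run o = (k (A.run o)).run o := by
  induction A with
  | output b => rfl
  | query S next ih => exact ih _

theorem numQueries_bind {V β γ : Type*} (o : Finset V → ℕ) (A : CutQueryAlgorithm V β)
    (k : β → CutQueryAlgorithm V γ) :
    (A.bind k).numQueries o = A.numQueries o + (k (A.run o)).numQueries o := by
  induction A with
  | output b => simp [bind, numQueries, run]
  | query S next ih => simp only [bind, numQueries, run, ih]; omega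

end CutQueryAlgorithm

/-! ### Specifications with a query bound, and neighbour search -/

section Solvable

variable {V : Type*} [Fintype V] [DecidableEq V] {β γ : Type*}

/-- Some algorithm makes at most `q` queries on every graph `G` in `𝒢`, and its output `b`
satisfies `P G b`. -/
def Solvable (𝒢 : Set (SimpleGraph V)) (q : ℕ) (P : SimpleGraph V → β → Prop) : Prop :=
  ∃ A : CutQueryAlgorithm V β,
    ∀ G ∈ 𝒢, A.numQueries (cutSize G) ≤ q ∧ P G (A.run (cutSize G))

namespace Solvable

variable {𝒢 𝒢' : Set (SimpleGraph V)} {q q' : ℕ} {P P' : SimpleGraph V → β → Prop}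

theorem pure (b : β) (h : ∀ G ∈ 𝒢, P G b) : Solvable 𝒢 q P :=
  ⟨.output b, fun G hG => ⟨Nat.zero_le _, h G hG⟩⟩

theorem mono (h : Solvable 𝒢 q P) (h𝒢 : 𝒢' ⊆ 𝒢) (hq : q ≤ q')
    (hP : ∀ G ∈ 𝒢', ∀ b, P G b → P' G b) : Solvable 𝒢' q' P' := by
  obtain ⟨A, hA⟩ := h
  exact ⟨A, fun G hG => ⟨(hA G (h𝒢 hG)).1.trans hq, hP G hG _ (hA G (h𝒢 hG)).2⟩⟩

/-- What the first algorithm learns shrinks the class of graphs that the second must handle.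
Invariants about the unknown graph are carried in this way. -/
theorem bind {Q : SimpleGraph V → γ → Prop} (h : Solvable 𝒢 q P)
    (hQ : ∀ b, Solvable {G | G ∈ 𝒢 ∧ P G b} q' Q) : Solvable 𝒢 (q + q') Q := by
  obtain ⟨A, hA⟩ := h
  choose B hB using hQ
  refine ⟨A.bind B, fun G hG => ?_⟩
  obtain ⟨h1, h2⟩ := hA G hG
  obtain ⟨h3, h4⟩ := hB _ G ⟨hG, h2⟩
  rw [CutQueryAlgorithm.run_bind, CutQueryAlgorithm.numQueries_bind]
  exact ⟨by omega, h4⟩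

theorem map {Q : SimpleGraph V → γ → Prop} (h : Solvable 𝒢 q P) (g : β → γ)
    (hQ : ∀ G ∈ 𝒢, ∀ b, P G b → Q G (g b)) : Solvable 𝒢 q Q :=
  h.bind (q' := 0) fun b => pure (g b) fun G hG => hQ G hG.1 b hG.2

theorem ask (S : Finset V) : Solvable 𝒢 1 fun G r => r = cutSize G S :=
  ⟨.query S .output, fun _ _ => ⟨le_rfl, rfl⟩⟩

theorem pi {ι : Type*} [Fintype ι] [Nonempty β] {P : ι → SimpleGraph V → β → Prop}
    (h : ∀ i, Solvable 𝒢 q (P i)) :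
    Solvable 𝒢 (Fintype.card ι * q) fun G (g : ι → β) => ∀ i, P i G (g i) := by
  classical
  have key : ∀ s : Finset ι, Solvable 𝒢 (s.card * q)
      fun G (g : ι → β) => ∀ i ∈ s, P i G (g i) := by
    intro s
    induction s using Finset.induction_on with
    | empty => exact pure (fun _ => Classical.arbitrary β) (by simp)
    | insert a s ha ih =>
      rw [Finset.card_insert_of_notMem ha, Nat.succ_mul]
      refine ih.bind fun g => ?_
      refine ((h a).mono (fun G hG => hG.1) le_rfl (P' := fun G b => (∀ i ∈ s, P i G (g i)) ∧
        P a G b) fun G hG b hb => ⟨hG.2, hb⟩).map (Function.update g a) ?_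
      rintro G - b ⟨h1, h2⟩ i hi
      by_cases hia : i = a
      · subst hia; simpa using h2
      · rw [Function.update_of_ne hia]
        exact h1 i ((Finset.mem_insert.1 hi).resolve_left hia)
  simpa using key Finset.univ

end Solvable

open Classical in
theorem cutSize_eq_sum (G : SimpleGraph V) (S : Finset V) :
    cutSize G S = ∑ v ∈ S, ∑ w ∈ Sᶜ, if G.Adj v w then 1 else 0 := by
  unfold cutSize SimpleGraph.interedges Rel.interedges
  rw [Finset.card_filter, Finset.sum_product]

open Classical in
theorem cutSize_eq_sum_univ (G : SimpleGraph V) (S : Finset V) :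
    cutSize G S = ∑ v, ∑ w, if G.Adj v w ∧ v ∈ S ∧ w ∉ S then 1 else 0 := by
  rw [cutSize_eq_sum, ← Finset.sum_filter_add_sum_filter_not Finset.univ (· ∈ S)]
  rw [Finset.sum_eq_zero (s := Finset.univ.filter (· ∉ S)), add_zero]
  · rw [Finset.filter_mem_eq_inter, Finset.univ_inter]
    refine Finset.sum_congr rfl fun v hv => ?_
    simp only [← Finset.card_filter]
    congr 1
    ext w
    simp [hv, and_comm]
  · intro v hv
    simp_all

theorem cutSize_compl (G : SimpleGraph V) (S : Finset V) : cutSize G Sᶜ = cutSize G S := by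
  classical
  rw [cutSize_eq_sum, cutSize_eq_sum, Finset.sum_comm, compl_compl]
  simp only [G.adj_comm]

theorem cutSize_union_add_cutSize_inter_le (G : SimpleGraph V) (A B : Finset V) :
    cutSize G (A ∪ B) + cutSize G (A ∩ B) ≤ cutSize G A + cutSize G B := by
  classical
  simp only [cutSize_eq_sum_univ, ← Finset.sum_add_distrib]
  refine Finset.sum_le_sum fun v _ => Finset.sum_le_sum fun w _ => ?_
  by_cases h : G.Adj v w <;> by_cases h1 : v ∈ A <;> by_cases h2 : v ∈ B <;>
    by_cases h3 : w ∈ A <;> by_cases h4 : w ∈ B <;> simp [h, h1, h2, h3, h4]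

-- Edges between u and T cross both cuts on the left but lie inside `insert u T`. Three queries thus
-- reveal the degree of u into T.
open Classical in
theorem cutSize_singleton_add (G : SimpleGraph V) {u : V} {T : Finset V} (hu : u ∉ T) :
    cutSize G {u} + cutSize G T = cutSize G (insert u T) + 2 * (T.filter (G.Adj u)).card := by
  have h1 : (T.filter (G.Adj u)).card = ∑ v, ∑ w, if G.Adj v w ∧ v = u ∧ w ∈ T then 1 else 0 := by
    rw [Finset.sum_eq_single u (by intro v _ hv; simp [hv]) (by simp), ← Finset.card_filter]
    congr 1; ext w; simp [and_comm]
  have h2 : (T.filter (G.Adj u)).card = ∑ v, ∑ w, if G.Adj v w ∧ w = u ∧ v ∈ T then 1 else 0 := by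
    rw [h1, Finset.sum_comm]
    simp only [G.adj_comm]
  rw [two_mul]
  nth_rw 1 [h1]
  rw [h2]
  simp only [cutSize_eq_sum_univ, ← Finset.sum_add_distrib]
  refine Finset.sum_congr rfl fun v _ => Finset.sum_congr rfl fun w _ => ?_
  by_cases h : G.Adj v w
  · have := h.ne
    by_cases h1 : v = u <;> by_cases h2 : w = u <;> by_cases h3 : v ∈ T <;> by_cases h4 : w ∈ T <;>
      simp_all
  · simp [h]

open Classical in
theorem solvable_degreeInto {𝒢 : Set (SimpleGraph V)} (u : V) (T : Finset V) (hu : u ∉ T) :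
    Solvable 𝒢 3 fun G r => r = (T.filter (G.Adj u)).card := by
  refine (Solvable.ask {u}).bind (q' := 2) fun r₁ => (Solvable.ask T).bind (q' := 1) fun r₂ =>
    (Solvable.ask (insert u T)).map (fun r₃ => (r₁ + r₂ - r₃) / 2) ?_
  rintro G ⟨⟨-, rfl⟩, rfl⟩ r₃ rfl
  have := cutSize_singleton_add G hu
  omega

/-- The subgraph of edges whose endpoints have the same `c`-value. -/
def cellGraph {κ : Type*} (c : V → κ) (G : SimpleGraph V) : SimpleGraph V where
  Adj u v := G.Adj u v ∧ c u = c v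
  symm := ⟨fun _ _ h => ⟨h.1.symm, h.2.symm⟩⟩
  loopless := ⟨fun _ h => h.1.ne rfl⟩

theorem solvable_findNeighbor_of_exists (u : V) (k : ℕ) : ∀ T : Finset V, u ∉ T → T.card ≤ 2 ^ k →
    Solvable {G | ∃ v ∈ T, G.Adj u v} (3 * k) fun G v => v ∈ T ∧ G.Adj u v := by
  classical
  induction k with
  | zero =>
    intro T _ hT
    rcases T.eq_empty_or_nonempty with rfl | ⟨v, hv⟩
    · exact .pure u (by simp)
    · refine .pure v ?_
      rintro G ⟨w, hw, h⟩
      rw [Finset.card_le_one.1 (by simpa using hT) v hv w hw]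
      exact ⟨hw, h⟩
  | succ k ih =>
    intro T hu hT
    obtain ⟨T₁, hT₁, hc⟩ := Finset.exists_subset_card_eq (Nat.div_le_self T.card 2)
    have hc₂ := Finset.card_sdiff_of_subset hT₁
    rw [pow_succ] at hT
    have hu₁ : u ∉ T₁ := fun h => hu (hT₁ h)
    have hu₂ : u ∉ T \ T₁ := fun h => hu (Finset.mem_sdiff.1 h).1
    rw [Nat.mul_succ, Nat.add_comm]
    refine (solvable_degreeInto u T₁ hu₁).bind fun r => ?_
    rcases Nat.eq_zero_or_pos r with hr | hr
    · refine (ih (T \ T₁) hu₂ (by omega)).mono ?_ le_rfl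
        fun G _ v hv => ⟨(Finset.mem_sdiff.1 hv.1).1, hv.2⟩
      rintro G ⟨⟨v, hv, h⟩, h0⟩
      refine ⟨v, Finset.mem_sdiff.2 ⟨hv, fun hv1 => ?_⟩, h⟩
      rw [hr, eq_comm, Finset.card_eq_zero] at h0
      exact Finset.notMem_empty v (h0 ▸ Finset.mem_filter.2 ⟨hv1, h⟩)
    · refine (ih T₁ hu₁ (by omega)).mono ?_ le_rfl fun G _ v hv => ⟨hT₁ hv.1, hv.2⟩
      rintro G ⟨-, h0⟩
      obtain ⟨v, hv⟩ := Finset.card_pos.1 (h0 ▸ hr)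
      exact ⟨v, Finset.mem_filter.1 hv⟩

/-- The cost of one search for a neighbour. -/
def findCost (V : Type*) [Fintype V] : ℕ := 3 * (Nat.clog 2 (Fintype.card V) + 1)

theorem solvable_findNeighbor {κ : Type*} (c : V → κ) {𝒢 : Set (SimpleGraph V)} (u : V)
    (T : Finset V) :
    Solvable 𝒢 (findCost V) fun G (o : Option V) =>
      (∀ v, o = some v → v ∈ T ∧ (cellGraph c G).Adj u v) ∧
      (o = none → ∀ v ∈ T, ¬ (cellGraph c G).Adj u v) := by
  classical
  -- Since c is known, restricting the search to the cell of u turns adjacency in `cellGraph` into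
  -- adjacency in G.
  set T' := T.filter fun v => v ≠ u ∧ c u = c v with hT'
  have hu : u ∉ T' := by simp [hT']
  unfold findCost
  rw [Nat.mul_succ, Nat.add_comm]
  refine (solvable_degreeInto u T' hu).bind fun r => ?_
  rcases Nat.eq_zero_or_pos r with hr | hr
  · refine .pure none ?_
    rintro G ⟨-, h0⟩
    refine ⟨by simp, fun _ v hv h => ?_⟩
    rw [hr, eq_comm, Finset.card_eq_zero] at h0
    refine Finset.notMem_empty v (h0 ▸ Finset.mem_filter.2 ⟨?_, h.1⟩)
    exact Finset.mem_filter.2 ⟨hv, h.1.ne', h.2⟩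
  · refine ((solvable_findNeighbor_of_exists u _ T' hu ((Finset.card_le_univ _).trans
      (Nat.le_pow_clog one_lt_two _))).mono ?_ le_rfl fun G _ v hv => hv).map some ?_
    · rintro G ⟨-, h0⟩
      obtain ⟨v, hv⟩ := Finset.card_pos.1 (h0 ▸ hr)
      exact ⟨v, Finset.mem_filter.1 hv⟩
    · rintro G - v ⟨hv, h⟩
      refine ⟨?_, by simp⟩
      rintro w hw
      obtain rfl := Option.some.inj hw
      obtain ⟨h1, -, h2⟩ := Finset.mem_filter.1 hv
      exact ⟨h1, h, h2⟩

theorem solvable_select {ι : Type*} [Fintype ι] {𝒢 : Set (SimpleGraph V)} (Z : ι → Finset V)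
    (p : Finset V → Prop) (τ : ℕ) :
    Solvable 𝒢 (Fintype.card ι) fun G X =>
      (∃ i, p (Z i) ∧ cutSize G (Z i) ≤ τ) → p X ∧ cutSize G X ≤ τ := by
  classical
  have := Solvable.pi (𝒢 := 𝒢) fun i => Solvable.ask (Z i)
  rw [mul_one] at this
  refine this.map (fun s => if h : ∃ i, p (Z i) ∧ s i ≤ τ then Z h.choose else ∅) ?_
  rintro G - s hs ⟨i, hi⟩
  have h : ∃ i, p (Z i) ∧ s i ≤ τ := ⟨i, by rwa [hs]⟩
  rw [dif_pos h, ← hs]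
  exact h.choose_spec

end Solvable

/-! ### Preflows, labels, and the bound on undelivered flow -/

section Flow

variable {V : Type*} [Fintype V] [DecidableEq V]

/-- An integral preflow with unit edge capacities on `H`: `f v w` is the flow on the arc `v → w`,
every vertex `v` supplies `α v` units, `b v ≤ β v` of the units arriving at `v` are absorbed
there, and `e v` units are waiting at `v`. -/
structure IsPreflow (H : SimpleGraph V) (α β : V → ℕ) (f : V → V → ℤ) (b e : V → ℕ) : Prop where
  antisymm : ∀ v w, f v w = - f w v
  le_one : ∀ v w, f v w ≤ 1
  adj : ∀ v w, f v w ≠ 0 → H.Adj v w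
  sink_le : ∀ v, b v ≤ β v
  conserve : ∀ v, ∑ w, f v w + b v + e v = α v

/-- Push one unit along the arc `u → v`. -/
def pushArc (f : V → V → ℤ) (u v : V) : V → V → ℤ := fun x y =>
  f x y + (if x = u ∧ y = v then 1 else 0) - (if x = v ∧ y = u then 1 else 0)

namespace IsPreflow

variable {H : SimpleGraph V} {α β : V → ℕ} {f : V → V → ℤ} {b e : V → ℕ}

theorem pushArc (h : IsPreflow H α β f b (e + Pi.single u 1)) {v : V} (huv : H.Adj u v)
    (hf : f u v ≤ 0) : IsPreflow H α β (pushArc f u v) b (e + Pi.single v 1) where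
  antisymm x y := by
    have := h.antisymm x y
    unfold _root_.pushArc
    simp only [and_comm (a := y = u), and_comm (a := y = v)]
    linarith
  le_one x y := by
    have := h.le_one x y
    unfold _root_.pushArc
    split_ifs with h1 h2
    · linarith
    · obtain ⟨rfl, rfl⟩ := h1
      linarith
    · linarith
    · linarith
  adj x y hxy := by
    by_cases h1 : x = u ∧ y = v
    · rw [h1.1, h1.2]; exact huv
    by_cases h2 : x = v ∧ y = u
    · rw [h2.1, h2.2]; exact huv.symm
    exact h.adj x y (by simpa [_root_.pushArc, h1, h2] using hxy)
  sink_le := h.sink_le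
  conserve x := by
    have := h.conserve x
    have h1 : ∑ y, (if x = u ∧ y = v then (1 : ℤ) else 0) = if x = u then 1 else 0 := by
      by_cases hx : x = u <;> simp [hx]
    have h2 : ∑ y, (if x = v ∧ y = u then (1 : ℤ) else 0) = if x = v then 1 else 0 := by
      by_cases hx : x = v <;> simp [hx]
    simp only [_root_.pushArc, Finset.sum_sub_distrib, Finset.sum_add_distrib, h1, h2]
    simp only [Pi.add_apply, Pi.single_apply] at this ⊢
    push_cast at this ⊢
    linarith

theorem absorb (h : IsPreflow H α β f b (e + Pi.single u 1)) (hb : b u < β u) :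
    IsPreflow H α β f (b + Pi.single u 1) e where
  antisymm := h.antisymm
  le_one := h.le_one
  adj := h.adj
  sink_le v := by
    have := h.sink_le v
    simp only [Pi.add_apply, Pi.single_apply]
    split_ifs with hv
    · subst hv; omega
    · omega
  conserve v := by
    have := h.conserve v
    simp only [Pi.add_apply] at this ⊢
    push_cast at this ⊢
    linarith

theorem neg_one_le (h : IsPreflow H α β f b e) (v w : V) : -1 ≤ f v w := by
  have := h.le_one w v
  rw [h.antisymm]; linarith

theorem sum_supply (h : IsPreflow H α β f b e) (Y : Finset V) :
    (∑ v ∈ Y, α v : ℤ) =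
      ∑ v ∈ Y, ∑ w ∈ Yᶜ, f v w + ∑ v ∈ Y, (b v : ℤ) + ∑ v ∈ Y, (e v : ℤ) := by
  have h0 : ∑ v ∈ Y, ∑ w ∈ Y, f v w = 0 := by
    have : ∑ v ∈ Y, ∑ w ∈ Y, f v w = - ∑ v ∈ Y, ∑ w ∈ Y, f v w := by
      conv_lhs => rw [Finset.sum_comm]
      simp only [← Finset.sum_neg_distrib]
      exact Finset.sum_congr rfl fun v _ => Finset.sum_congr rfl fun w _ => h.antisymm _ _
    linarith
  have h1 : ∀ v, (α v : ℤ) = ∑ w ∈ Y, f v w + ∑ w ∈ Yᶜ, f v w + b v + e v := fun v => by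
    rw [Finset.sum_add_sum_compl, h.conserve]
  simp only [h1, Finset.sum_add_distrib, h0, zero_add]

/-- Weak duality: every Y bounds from below the number of units left waiting by any preflow. -/
theorem sum_supply_le (h : IsPreflow H α β f b e) (Y : Finset V) :
    ∑ v ∈ Y, α v ≤ cutSize H Y + ∑ v ∈ Y, β v + ∑ v, e v := by
  classical
  have h1 := h.sum_supply Y
  have h2 : ∑ v ∈ Y, ∑ w ∈ Yᶜ, f v w ≤ cutSize H Y := by
    rw [cutSize_eq_sum]
    push_cast
    refine Finset.sum_le_sum fun v _ => Finset.sum_le_sum fun w _ => ?_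
    split_ifs with hvw
    · exact h.le_one v w
    · by_contra! h3
      exact hvw (h.adj v w h3.ne')
  have h3 : ∑ v ∈ Y, b v ≤ ∑ v ∈ Y, β v := Finset.sum_le_sum fun v _ => h.sink_le v
  have h4 : ∑ v ∈ Y, e v ≤ ∑ v, e v := Finset.sum_le_sum_of_subset (Finset.subset_univ _)
  zify at *
  linarith

-- Approximate tightness of weak duality. An arc leaving Y carries a full unit unless it is
-- residual; then it falls short by at most 2, because flows are at least -1, and g pays for this.
open Classical in
theorem cutSize_add_le (h : IsPreflow H α β f b e) (Y : Finset V) (g : V → V → ℕ)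
    (hb : ∀ v ∈ Y, b v = β v) (he : ∀ v ∉ Y, e v = 0)
    (hf : ∀ v ∈ Y, ∀ w ∈ Yᶜ, H.Adj v w → f v w ≤ 0 → 2 ≤ g v w) :
    cutSize H Y + ∑ v ∈ Y, β v + ∑ v, e v ≤ ∑ v ∈ Y, α v + ∑ v ∈ Y, ∑ w ∈ Yᶜ, g v w := by
  have h1 := h.sum_supply Y
  have h2 : (cutSize H Y : ℤ) ≤ ∑ v ∈ Y, ∑ w ∈ Yᶜ, f v w + ∑ v ∈ Y, ∑ w ∈ Yᶜ, (g v w : ℤ) := by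
    rw [cutSize_eq_sum]
    push_cast
    simp only [← Finset.sum_add_distrib]
    refine Finset.sum_le_sum fun v hv => Finset.sum_le_sum fun w hw => ?_
    have h3 := h.neg_one_le v w
    by_cases hvw : H.Adj v w
    · rw [if_pos hvw]
      by_cases h4 : f v w ≤ 0
      · have := hf v hv w hw hvw h4
        omega
      · omega
    · have : f v w = 0 := by
        by_contra h3
        exact hvw (h.adj v w h3)
      simp [hvw, this]
  have h3 : ∑ v ∈ Y, b v = ∑ v ∈ Y, β v := Finset.sum_congr rfl hb
  have h4 : ∑ v ∈ Y, e v = ∑ v, e v := Finset.sum_subset (Finset.subset_univ _) fun v _ => he v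
  zify at *
  linarith

end IsPreflow

/-- `d` is a valid distance labelling, with labels at most `D`, for the residual arcs of `f`. -/
structure IsLabelling (H : SimpleGraph V) (β : V → ℕ) (f : V → V → ℤ) (b d : V → ℕ) (D : ℕ) :
    Prop where
  valid : ∀ v w, H.Adj v w → f v w ≤ 0 → d v ≤ d w + 1
  sink : ∀ v, b v < β v → d v = 0
  le : ∀ v, d v ≤ D

namespace IsLabelling

variable {H : SimpleGraph V} {α β : V → ℕ} {f : V → V → ℤ} {b d e : V → ℕ} {D : ℕ}

theorem pushArc (h : IsLabelling H β f b d D) {u v : V} (hd : d v + 1 = d u) :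
    IsLabelling H β (pushArc f u v) b d D where
  valid x y hxy hf := by
    by_cases h2 : x = v ∧ y = u
    · rw [h2.1, h2.2]; omega
    · refine h.valid x y hxy (le_trans ?_ hf)
      unfold _root_.pushArc
      rw [if_neg h2]
      split_ifs <;> linarith
  sink := h.sink
  le := h.le

theorem absorb (h : IsLabelling H β f b d D) (u : V) :
    IsLabelling H β f (b + Pi.single u 1) d D where
  valid := h.valid
  sink v hv := h.sink v (lt_of_le_of_lt (by simp) hv)
  le := h.le

theorem relabel (h : IsLabelling H β f b d D) {u : V} (hD : d u ≠ D) (hb : ¬ b u < β u)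
    (hu : ∀ v, d v + 1 = d u → f u v ≤ 0 → ¬ H.Adj u v) :
    IsLabelling H β f b (d + Pi.single u 1) D where
  valid x y hxy hf := by
    have h1 := h.valid x y hxy hf
    simp only [Pi.add_apply, Pi.single_apply]
    by_cases hx : x = u
    · subst hx
      rw [if_pos rfl, if_neg hxy.ne']
      have : d y + 1 ≠ d x := fun h3 => hu y h3 hf hxy
      omega
    · rw [if_neg hx]; omega
  sink v hv := by
    have h1 : v ≠ u := by rintro rfl; exact hb hv
    simpa [Pi.single_apply, h1] using h.sink v hv
  le v := by
    have h1 := h.le v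
    simp only [Pi.add_apply, Pi.single_apply]
    split_ifs with hv
    · subst hv; omega
    · omega

/-- Averaging over D consecutive pairs gives two levels of total size at most 2n/D. By AM-GM their
product is at most (n/D)^2 ≤ D. -/
theorem exists_sparse_levels (d : V → ℕ) {D : ℕ} (hD : 0 < D) (hn : Fintype.card V ^ 2 ≤ D ^ 3) :
    ∃ i < D, (Finset.univ.filter fun v => d v = i + 1).card *
      (Finset.univ.filter fun v => d v = i).card ≤ D := by
  set L : ℕ → ℕ := fun i => (Finset.univ.filter fun v => d v = i).card with hL
  have hsum : ∀ m, ∑ i ∈ Finset.range m, L i ≤ Fintype.card V := by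
    intro m
    rw [hL, ← Finset.card_biUnion]
    · exact Finset.card_le_univ _
    · intro i _ j _ hij
      refine Finset.disjoint_left.2 fun v hv hv' => hij ?_
      simp only [Finset.mem_filter] at hv hv'
      exact hv.2.symm.trans hv'.2
  have h1 : ∑ i ∈ Finset.range D, (L (i + 1) + L i) ≤ 2 * Fintype.card V := by
    rw [Finset.sum_add_distrib]
    have h2 := hsum (D + 1)
    rw [Finset.sum_range_succ'] at h2
    have h3 := hsum D
    omega
  obtain ⟨i, hi, h2⟩ : ∃ i ∈ Finset.range D, D * (L (i + 1) + L i) ≤ 2 * Fintype.card V := by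
    by_contra! h
    have h3 : ∑ i ∈ Finset.range D, (2 * Fintype.card V) <
        ∑ i ∈ Finset.range D, D * (L (i + 1) + L i) :=
      Finset.sum_lt_sum_of_nonempty ⟨0, Finset.mem_range.2 hD⟩ h
    rw [Finset.sum_const, Finset.card_range, smul_eq_mul, ← Finset.mul_sum] at h3
    exact absurd h1 (not_le.2 (Nat.lt_of_mul_lt_mul_left h3))
  refine ⟨i, Finset.mem_range.1 hi, ?_⟩
  change L (i + 1) * L i ≤ D
  have h4 : 4 * (L (i + 1) * L i) ≤ (L (i + 1) + L i) ^ 2 := by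
    zify; nlinarith [sq_nonneg ((L (i + 1) : ℤ) - L i)]
  have h5 : (D * (L (i + 1) + L i)) ^ 2 ≤ (2 * Fintype.card V) ^ 2 := Nat.pow_le_pow_left h2 2
  have h6 : D ^ 2 * (L (i + 1) * L i) ≤ D ^ 2 * D := by nlinarith [Nat.mul_le_mul_left (D ^ 2) h4]
  exact Nat.le_of_mul_le_mul_left h6 (by positivity)

/-- If all waiting units have the largest label `D`, then at most `2 * D` of them can still be
routed. -/
theorem exists_cut (h : IsLabelling H β f b d D) (hf : IsPreflow H α β f b e) (hD : 0 < D)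
    (hn : Fintype.card V ^ 2 ≤ D ^ 3) (he : ∀ v, 0 < e v → d v = D) :
    ∃ Y, cutSize H Y + ∑ v ∈ Y, β v + ∑ v, e v ≤ ∑ v ∈ Y, α v + 2 * D := by
  classical
  obtain ⟨i, hi, hL⟩ := exists_sparse_levels d hD hn
  -- Cut between the two sparse levels: a residual arc descends at most one label, so those leaving
  -- this set run from level i + 1 to level i.
  refine ⟨Finset.univ.filter fun v => i < d v, (hf.cutSize_add_le _
    (fun v w => if d v = i + 1 ∧ d w = i then 2 else 0) ?_ ?_ ?_).trans ?_⟩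
  · intro v hv
    have h1 := (Finset.mem_filter.1 hv).2
    refine le_antisymm (hf.sink_le v) (not_lt.1 fun h2 => ?_)
    rw [h.sink v h2] at h1; omega
  · intro v hv
    by_contra h1
    have := he v (Nat.pos_of_ne_zero h1)
    simp at hv; omega
  · intro v hv w hw hvw h1
    have := h.valid v w hvw h1
    simp at hv hw
    rw [if_pos (by omega)]
  · gcongr
    refine le_trans ?_ (Nat.mul_le_mul_left 2 hL)
    rw [← Finset.card_product, mul_comm, ← smul_eq_mul, ← Finset.sum_const, Finset.sum_product,
      Finset.sum_filter (fun v => d v = i + 1)]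
    refine (Finset.sum_le_sum_of_subset (Finset.subset_univ _)).trans
      (Finset.sum_le_sum fun v _ => ?_)
    by_cases hv : d v = i + 1
    · simp only [hv, true_and, if_true]
      rw [Finset.sum_filter]
      exact Finset.sum_le_sum_of_subset (Finset.subset_univ _)
    · simp [hv]

end IsLabelling

end Flow

/-! ### Minimum cuts by push-relabel and augmentation -/

section MinCut

variable {V : Type*} [Fintype V] [DecidableEq V] {κ : Type*}

/-- Potential of the push-relabel phase with pending units at the vertices in `l`, the first of
which is being moved. -/
def pushPotential (D : ℕ) (d : V → ℕ) (l : List V) : ℕ :=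
  2 * ∑ v, (D - d v) + (D + 1) * l.length + (l.head?.map d).getD 0

/-- The weight D + 1 per unit pays for the next unit starting at a label up to D. The factor 2 on
the labels pays for a relabelling, which raises the label of the moving unit by 1. -/
theorem pushPotential_tail_lt {D : ℕ} {d : V → ℕ} (hd : ∀ v, d v ≤ D) (u : V) (l : List V) :
    pushPotential D d l < pushPotential D d (u :: l) := by
  have : (l.head?.map d).getD 0 ≤ D := by
    cases l with
    | nil => simp
    | cons v l => simpa using hd v
  simp only [pushPotential, List.length_cons, mul_add, mul_one]
  omega

theorem pushPotential_relabel_lt {D : ℕ} {d : V → ℕ} {u : V} (hu : d u < D) (l : List V) :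
    pushPotential D (d + Pi.single u 1) (u :: l) < pushPotential D d (u :: l) := by
  have : ∑ v, (D - (d + Pi.single u 1 : V → ℕ) v) + 1 = ∑ v, (D - d v) := by
    rw [← Finset.add_sum_erase _ _ (Finset.mem_univ u),
      ← Finset.add_sum_erase Finset.univ (fun v => D - d v) (Finset.mem_univ u),
      Finset.sum_congr rfl (g := fun v => D - d v)]
    · simp only [Pi.add_apply, Pi.single_eq_same]; omega
    · intro v hv
      simp [Finset.ne_of_mem_erase hv]
  simp only [pushPotential, List.head?_cons, Option.map_some, Option.getD_some, Pi.add_apply,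
    Pi.single_eq_same] at this ⊢
  omega

theorem add_count_cons (x : V → ℕ) (u : V) (l : List V) :
    (fun v => x v + (u :: l).count v) = (fun v => x v + l.count v) + Pi.single u 1 := by
  ext v
  by_cases h : v = u
  · subst h; simp [add_assoc]
  · simp [h, Ne.symm h]

/-- The data kept by the push-relabel phase: flow, absorbed units, waiting units, labels. -/
abbrev PushState (V : Type*) := (V → V → ℤ) × (V → ℕ) × (V → ℕ) × (V → ℕ)

/-- Units in l are still to be moved; x counts those parked at label D. Every search leads to a push
or a relabelling, either of which lowers the potential. -/
theorem solvable_pushRelabel (c : V → κ) (α β : V → ℕ) (D m : ℕ) :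
    ∀ (f : V → V → ℤ) (b x d : V → ℕ) (l : List V), pushPotential D d l ≤ m →
    Solvable {G | IsPreflow (cellGraph c G) α β f b (fun v => x v + l.count v) ∧
        IsLabelling (cellGraph c G) β f b d D ∧ ∀ v, 0 < x v → d v = D} (m * findCost V)
      fun G (s : PushState V) => IsPreflow (cellGraph c G) α β s.1 s.2.1 s.2.2.1 ∧
        IsLabelling (cellGraph c G) β s.1 s.2.1 s.2.2.2 D ∧
        ∀ v, 0 < s.2.2.1 v → s.2.2.2 v = D := by
  induction m with
  | zero =>
    intro f b x d l hl
    cases l with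
    | nil => exact .pure (f, b, x, d) fun G hG => by simpa using hG
    | cons u l => simp [pushPotential] at hl
  | succ m ih =>
    intro f b x d l hl
    rcases l with - | ⟨u, l⟩
    · exact .pure (f, b, x, d) fun G hG => by simpa using hG
    by_cases hd : ∀ v, d v ≤ D
    swap
    · exact .pure (f, b, x, d) fun G hG => (hd hG.2.1.le).elim
    have hle : m * findCost V ≤ (m + 1) * findCost V := Nat.mul_le_mul_right _ m.le_succ
    have htail := pushPotential_tail_lt hd u l
    simp only [add_count_cons]
    by_cases hu : d u = D
    · refine (ih f b (x + Pi.single u 1) d l (by omega)).mono ?_ hle fun G _ s hs => hs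
      rintro G ⟨h1, h2, h3⟩
      refine ⟨?_, h2, fun v hv => ?_⟩
      · convert h1 using 2
        simp only [Pi.add_apply]; omega
      · by_cases hvu : v = u
        · rw [hvu, hu]
        · exact h3 v (by simpa [Pi.single_apply, hvu] using hv)
    by_cases hb : b u < β u
    · refine (ih f (b + Pi.single u 1) x d l (by omega)).mono ?_ hle fun G _ s hs => hs
      rintro G ⟨h1, h2, h3⟩
      exact ⟨h1.absorb hb, h2.absorb u, h3⟩
    rw [Nat.succ_mul, Nat.add_comm]
    refine (solvable_findNeighbor c u
      (Finset.univ.filter fun v => d v + 1 = d u ∧ f u v ≤ 0)).bind fun o => ?_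
    rcases o with - | v
    · have := pushPotential_relabel_lt (lt_of_le_of_ne (hd u) hu) l
      refine (ih f b x (d + Pi.single u 1) (u :: l) (by omega)).mono ?_ le_rfl fun G _ s hs => hs
      rintro G ⟨⟨h1, h2, h3⟩, -, h4⟩
      refine ⟨by rwa [add_count_cons], h2.relabel hu hb fun v hv hf => ?_, fun v hv => ?_⟩
      · exact h4 rfl v (by simp [hv, hf])
      · have hvu : v ≠ u := by rintro rfl; exact hu (h3 _ hv)
        simpa [Pi.single_apply, hvu] using h3 v hv
    · by_cases hv : d v + 1 = d u ∧ f u v ≤ 0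
      · refine (ih (pushArc f u v) b x d (v :: l) ?_).mono ?_ le_rfl fun G _ s hs => hs
        · simp only [pushPotential, List.length_cons, List.head?_cons, Option.map_some,
            Option.getD_some] at hl ⊢
          omega
        · rintro G ⟨⟨h1, h2, h3⟩, h4, -⟩
          refine ⟨?_, h2.pushArc hv.1, h3⟩
          rw [add_count_cons]
          exact h1.pushArc (h4 v rfl).2 hv.2
      -- The tree must also cover search results that no admissible graph produces; its output there
      -- is arbitrary.
      · refine .pure (f, b, x, d) ?_
        rintro G ⟨-, h4, -⟩
        exact (hv (by simpa using (h4 v rfl).1)).elim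

/-- From every vertex of `Y`, following the pointers `p` along residual arcs of `f` decreases the
rank `r` until free sink capacity is reached. -/
def IsSinkForest (H : SimpleGraph V) (β : V → ℕ) (f : V → V → ℤ) (b : V → ℕ) (Y : Finset V)
    (r : V → ℕ) (p : V → V) : Prop :=
  ∀ v ∈ Y, b v < β v ∨ (p v ∈ Y ∧ r (p v) < r v ∧ H.Adj v (p v) ∧ f v (p v) ≤ 0)

/-- Backward search from the free sinks: Y is reached and P ⊆ Y is exhausted. Each search enlarges
one of them, hence at most 2n searches. -/
theorem solvable_sinkSearch (c : V → κ) (α β : V → ℕ) (f : V → V → ℤ) (b e : V → ℕ) (m : ℕ) :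
    ∀ (Y P : Finset V) (r : V → ℕ) (p : V → V), P ⊆ Y →
      2 * Fintype.card V ≤ Y.card + P.card + m →
    Solvable {G | IsPreflow (cellGraph c G) α β f b e ∧ IsSinkForest (cellGraph c G) β f b Y r p ∧
        (∀ v ∈ Y, r v < Y.card) ∧ (∀ v, b v < β v → v ∈ Y) ∧
        ∀ v ∉ Y, ∀ w ∈ P, (cellGraph c G).Adj v w → 0 < f v w} (m * findCost V)
      fun G (s : Finset V × (V → ℕ) × (V → V)) =>
        IsSinkForest (cellGraph c G) β f b s.1 s.2.1 s.2.2 ∧ (∀ v, b v < β v → v ∈ s.1) ∧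
        ∀ v ∉ s.1, ∀ w ∈ s.1, (cellGraph c G).Adj v w → 0 < f v w := by
  induction m with
  | zero =>
    intro Y P r p hPY hm
    have h1 := Finset.card_le_univ Y
    have h2 := Finset.card_le_univ P
    have h3 : P = Y := Finset.eq_of_subset_of_card_le hPY (by omega)
    exact .pure (Y, r, p) fun G hG => ⟨hG.2.1, hG.2.2.2.1, h3 ▸ hG.2.2.2.2⟩
  | succ m ih =>
    intro Y P r p hPY hm
    by_cases hP : P = Y
    · exact .pure (Y, r, p) fun G hG => ⟨hG.2.1, hG.2.2.2.1, hP ▸ hG.2.2.2.2⟩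
    obtain ⟨w, hwY, hwP⟩ := Finset.exists_of_ssubset (hPY.ssubset_of_ne hP)
    rw [Nat.succ_mul, Nat.add_comm]
    refine (solvable_findNeighbor c w
      (Finset.univ.filter fun v => v ∉ Y ∧ f v w ≤ 0)).bind fun o => ?_
    rcases o with - | v
    · refine (ih Y (insert w P) r p (Finset.insert_subset hwY hPY) ?_).mono ?_ le_rfl
        fun G _ s hs => hs
      · rw [Finset.card_insert_of_notMem hwP]; omega
      · rintro G ⟨⟨h1, h2, h3, h4, h5⟩, -, h6⟩
        refine ⟨h1, h2, h3, h4, fun v hv u hu hvu => ?_⟩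
        rcases Finset.mem_insert.1 hu with rfl | hu
        · by_contra! h7
          exact h6 rfl v (by simp [hv, h7]) hvu.symm
        · exact h5 v hv u hu hvu
    · by_cases hv : v ∉ Y ∧ f v w ≤ 0
      -- The rank |Y| exceeds all ranks given so far, so the new pointer decreases rank.
      · refine (ih (insert v Y) P (Function.update r v Y.card) (Function.update p v w)
          (hPY.trans (Finset.subset_insert _ _)) ?_).mono ?_ le_rfl fun G _ s hs => hs
        · rw [Finset.card_insert_of_notMem hv.1]; omega
        · rintro G ⟨⟨h1, h2, h3, h4, h5⟩, h6, -⟩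
          have hne : ∀ u ∈ Y, u ≠ v := by rintro u hu rfl; exact hv.1 hu
          refine ⟨h1, fun u hu => ?_, fun u hu => ?_, fun u hu => Finset.mem_insert_of_mem (h4 u hu),
            fun u hu => h5 u fun h => hu (Finset.mem_insert_of_mem h)⟩
          · rcases Finset.mem_insert.1 hu with rfl | hu
            · right
              rw [Function.update_self, Function.update_self, Function.update_of_ne (hne w hwY)]
              exact ⟨Finset.mem_insert_of_mem hwY, h3 w hwY, (h6 u rfl).2.symm, hv.2⟩
            · refine (h2 u hu).imp_right fun h => ?_
              rw [Function.update_of_ne (hne u hu), Function.update_of_ne (hne u hu),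
                Function.update_of_ne (hne _ h.1)]
              exact ⟨Finset.mem_insert_of_mem h.1, h.2⟩
          · rw [Finset.card_insert_of_notMem hv.1]
            rcases Finset.mem_insert.1 hu with rfl | hu
            · simp
            · rw [Function.update_of_ne (hne u hu)]
              exact (h3 u hu).trans (Nat.lt_succ_self _)
      · refine .pure (Y, r, p) ?_
        rintro G ⟨-, h4, -⟩
        exact (hv (by simpa using (h4 v rfl).1)).elim

/-- The unit waiting at `v` can be routed along a sink forest, in a way that does not depend on the
graph. -/
theorem IsSinkForest.exists_augment (α β : V → ℕ) (Y : Finset V) (r : V → ℕ) (p : V → V) (b e : V → ℕ)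
    (k : ℕ) : ∀ (f : V → V → ℤ) (v : V), r v < k → ∃ (f' : V → V → ℤ) (b' : V → ℕ),
    ∀ H : SimpleGraph V, IsPreflow H α β f b (e + Pi.single v 1) →
      IsSinkForest H β f b (Y.filter fun u => r u ≤ r v) r p → v ∈ Y →
      IsPreflow H α β f' b' e := by
  induction k with
  | zero => intro f v hv; omega
  | succ k ih =>
    intro f v hv
    by_cases hb : b v < β v
    · exact ⟨f, b + Pi.single v 1, fun H h _ _ => h.absorb hb⟩
    by_cases hr : r (p v) < r v
    · obtain ⟨f', b', h⟩ := ih (pushArc f v (p v)) (p v) (by omega)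
      refine ⟨f', b', fun H hf hY hv => ?_⟩
      obtain ⟨h1, h2, h3, h4⟩ :=
        (hY v (Finset.mem_filter.2 ⟨hv, le_rfl⟩)).resolve_left hb
      refine h H (hf.pushArc h3 h4) (fun u hu => ?_) (Finset.mem_filter.1 h1).1
      obtain ⟨hu1, hu2⟩ := Finset.mem_filter.1 hu
      refine (hY u (Finset.mem_filter.2 ⟨hu1, by omega⟩)).imp_right fun h => ?_
      refine ⟨Finset.mem_filter.2 ⟨(Finset.mem_filter.1 h.1).1, by omega⟩, h.2.1, h.2.2.1, ?_⟩
      -- Ranks at most `r (p v)` exclude v, so the push does not increase the flow on the remaining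
      -- pointer arcs.
      have huv : u ≠ v := by rintro rfl; omega
      have := h.2.2.2
      simp only [pushArc, huv, false_and, if_false]
      split_ifs <;> linarith
    · refine ⟨f, b, fun H _ hY hv => ?_⟩
      exact (hr ((hY v (Finset.mem_filter.2 ⟨hv, le_rfl⟩)).resolve_left hb).2.1).elim

/-- The value of the cut `X` in the network that arises from `H` by joining every vertex `v` to a
source by `α v` edges and to a sink by `β v` edges. -/
noncomputable def terminalCut (H : SimpleGraph V) (α β : V → ℕ) (X : Finset V) : ℕ :=
  cutSize H X + ∑ v ∈ Xᶜ, α v + ∑ v ∈ X, β v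

/-- No residual arc enters Y and all free sinks lie in Y, so weak duality is tight at Yᶜ once no
unit waits in Y. -/
theorem terminalCut_compl_le {H : SimpleGraph V} {α β : V → ℕ} {f : V → V → ℤ} {b e : V → ℕ}
    (h : IsPreflow H α β f b e) {Y : Finset V} (hb : ∀ v, b v < β v → v ∈ Y)
    (hf : ∀ v ∉ Y, ∀ w ∈ Y, H.Adj v w → 0 < f v w) (he : ∀ v ∈ Y, e v = 0) (Z : Finset V) :
    terminalCut H α β Yᶜ ≤ terminalCut H α β Z := by
  have h1 := h.cutSize_add_le Yᶜ (fun _ _ => 0)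
    (fun v hv => le_antisymm (h.sink_le v) (not_lt.1 fun h1 => Finset.mem_compl.1 hv (hb v h1)))
    (fun v hv => he v (by simpa using hv))
    (fun v hv w hw hvw h1 => absurd (hf v (Finset.mem_compl.1 hv) w (by simpa using hw) hvw)
      (not_lt.2 h1))
  have h2 := h.sum_supply_le Z
  have h3 := Finset.sum_add_sum_compl Z α
  have h4 := Finset.sum_add_sum_compl Y α
  simp only [Finset.sum_const_zero, add_zero] at h1
  unfold terminalCut
  rw [compl_compl]
  omega

/-- Either a waiting unit reaches a free sink, or the unreached set is a minimum cut. The algorithm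
does not know the set Y in the hypothesis, which only certifies that at most k augmentations remain.
-/
theorem solvable_augment_step (c : V → κ) (α β : V → ℕ) (k q : ℕ) (f : V → V → ℤ) (b e : V → ℕ)
    (next : ∀ (f' : V → V → ℤ) (b' e' : V → ℕ), ∑ v, e' v + 1 = ∑ v, e v →
      Solvable {G | IsPreflow (cellGraph c G) α β f' b' e' ∧
        ∃ Y, cutSize (cellGraph c G) Y + ∑ v ∈ Y, β v + ∑ v, e v ≤ ∑ v ∈ Y, α v + k} q
      fun G X => ∀ Y, terminalCut (cellGraph c G) α β X ≤ terminalCut (cellGraph c G) α β Y) :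
    Solvable {G | IsPreflow (cellGraph c G) α β f b e ∧
        ∃ Y, cutSize (cellGraph c G) Y + ∑ v ∈ Y, β v + ∑ v, e v ≤ ∑ v ∈ Y, α v + k}
      (2 * Fintype.card V * findCost V + q)
      fun G X => ∀ Y, terminalCut (cellGraph c G) α β X ≤ terminalCut (cellGraph c G) α β Y := by
  refine ((solvable_sinkSearch c α β f b e _ (Finset.univ.filter fun v => b v < β v) ∅
    (fun _ => 0) id (by simp) (Nat.le_add_left _ _)).mono ?_ le_rfl fun G _ s hs => hs).bind ?_
  · rintro G ⟨h1, -⟩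
    refine ⟨h1, fun v hv => .inl (by simpa using hv), fun v hv => Finset.card_pos.2 ⟨v, hv⟩,
      by simp, by simp⟩
  rintro ⟨Y, r, p⟩
  by_cases hv : ∃ v ∈ Y, 0 < e v
  · obtain ⟨v, hvY, hv⟩ := hv
    have he : (e - Pi.single v 1 : V → ℕ) + Pi.single v 1 = e := by
      ext u
      by_cases hu : u = v
      · subst hu; simp; omega
      · simp [hu]
    obtain ⟨f', b', h⟩ := IsSinkForest.exists_augment α β Y r p b (e - Pi.single v 1) _ f v
      (Nat.lt_succ_self _)
    refine (next f' b' (e - Pi.single v 1) ?_).mono ?_ le_rfl fun G _ s hs => hs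
    · conv_rhs => rw [← he]
      simp [Finset.sum_add_distrib]
    · rintro G ⟨⟨h1, h2⟩, h3, -⟩
      refine ⟨h _ (he.symm ▸ h1) (fun u hu => ?_) hvY, h2⟩
      obtain ⟨hu1, hu2⟩ := Finset.mem_filter.1 hu
      exact (h3 u hu1).imp_right fun h4 =>
        ⟨Finset.mem_filter.2 ⟨h4.1, h4.2.1.le.trans hu2⟩, h4.2⟩
  · push Not at hv
    exact .pure Yᶜ fun G hG => terminalCut_compl_le hG.1.1 hG.2.2.1 hG.2.2.2
      fun v hv' => Nat.le_zero.1 (hv v hv')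

theorem solvable_augment (c : V → κ) (α β : V → ℕ) (k : ℕ) :
    ∀ (f : V → V → ℤ) (b e : V → ℕ),
    Solvable {G | IsPreflow (cellGraph c G) α β f b e ∧
        ∃ Y, cutSize (cellGraph c G) Y + ∑ v ∈ Y, β v + ∑ v, e v ≤ ∑ v ∈ Y, α v + k}
      ((k + 1) * (2 * Fintype.card V * findCost V))
      fun G X => ∀ Y, terminalCut (cellGraph c G) α β X ≤ terminalCut (cellGraph c G) α β Y := by
  induction k with
  | zero =>
    intro f b e
    rw [zero_add, one_mul]
    -- With k = 0 a further augmentation would violate weak duality at Y, so the output ∅ is never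
    -- reached.
    refine solvable_augment_step c α β 0 0 f b e fun f' b' e' he => .pure ∅ ?_
    rintro G ⟨h1, Y, h2⟩
    have := h1.sum_supply_le Y
    omega
  | succ k ih =>
    intro f b e
    rw [Nat.succ_mul, Nat.add_comm (_ * _)]
    refine solvable_augment_step c α β (k + 1) _ f b e fun f' b' e' he =>
      (ih f' b' e').mono ?_ le_rfl fun G _ s hs => hs
    rintro G ⟨h1, Y, h2⟩
    exact ⟨h1, Y, by omega⟩

/-- The cost of computing a minimum cut by flow with supply at most `F` and labels at most `D`. -/
def minCutCost (V : Type*) [Fintype V] (D F : ℕ) : ℕ :=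
  (2 * (Fintype.card V * D) + (D + 1) * F) * findCost V +
    (2 * D + 1) * (2 * Fintype.card V * findCost V)

theorem solvable_minCut {𝒢 : Set (SimpleGraph V)} (c : V → κ) (α β : V → ℕ) {D F : ℕ} (hD : 0 < D)
    (hn : Fintype.card V ^ 2 ≤ D ^ 3) (hF : ∑ v, α v ≤ F) :
    Solvable 𝒢 (minCutCost V D F)
      fun G X => ∀ Y, terminalCut (cellGraph c G) α β X ≤ terminalCut (cellGraph c G) α β Y := by
  set l : List V := (∑ v, Multiset.replicate (α v) v).toList with hl
  have hcount : ∀ v, l.count v = α v := fun v => by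
    rw [← Multiset.coe_count, hl, Multiset.coe_toList, Multiset.count_sum']
    simp [Multiset.count_replicate]
  have hlen : l.length = ∑ v, α v := by
    rw [hl, Multiset.length_toList]
    simp
  refine ((solvable_pushRelabel c α β D _ (fun _ _ => 0) (fun _ => 0) (fun _ => 0) (fun _ => 0) l
    ?_).mono ?_ le_rfl fun G _ s hs => hs).bind ?_
  · have h0 : (l.head?.map fun _ => 0).getD 0 = 0 := by cases l <;> rfl
    simp only [pushPotential, h0, hlen, Nat.sub_zero, Finset.sum_const, Finset.card_univ,
      smul_eq_mul, add_zero]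
    gcongr
  · intro G _
    exact ⟨⟨by simp, by simp, by simp, by simp, by simp [hcount]⟩, ⟨by simp, by simp, by simp⟩,
      by simp⟩
  · rintro ⟨f, b, x, d⟩
    refine (solvable_augment c α β (2 * D) f b x).mono ?_ le_rfl fun G _ s hs => hs
    rintro G ⟨-, h1, h2, h3⟩
    exact ⟨h1, h2.exists_cut h1 hD hn h3⟩

end MinCut

/-! ### Isolating cuts -/

section IsolatingCuts

variable {V : Type*} [Fintype V] [DecidableEq V] {κ : Type*}

theorem cellGraph_const (k : κ) (G : SimpleGraph V) : cellGraph (fun _ => k) G = G := by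
  ext u v; simp [cellGraph]

theorem terminalCut_compl (H : SimpleGraph V) (α β : V → ℕ) (X : Finset V) :
    terminalCut H α β Xᶜ = terminalCut H β α X := by
  unfold terminalCut
  rw [cutSize_compl, compl_compl]
  omega

/-- Uncrossing: compared with X, the set X ∪ C pays no more at the sink and saves the supply of C \
X. By submodularity `cutSize G (C ∩ X)` plus that supply is at most `cutSize G C`. -/
theorem cutSize_inter_le_of_minCut {G : SimpleGraph V} {α β : V → ℕ} {X C : Finset V} {v : V}
    (hX : ∀ Y, terminalCut G α β X ≤ terminalCut G α β Y) (hv : v ∈ C) (hα : cutSize G C < α v)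
    (hβ : ∀ u ∈ C, β u = 0) : v ∈ X ∧ cutSize G (C ∩ X) ≤ cutSize G C := by
  have h1 := hX (X ∪ C)
  have h2 := cutSize_union_add_cutSize_inter_le G X C
  have h3 : ∑ u ∈ Xᶜ, α u = ∑ u ∈ (X ∪ C)ᶜ, α u + ∑ u ∈ C \ X, α u := by
    rw [← Finset.sum_union (Finset.disjoint_left.2 fun u hu hu' => by simp_all)]
    congr 1; ext u; simp; tauto
  have h4 : ∑ u ∈ X ∪ C, β u = ∑ u ∈ X, β u := by
    refine (Finset.sum_subset Finset.subset_union_left fun u hu hu' => hβ u ?_).symm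
    exact (Finset.mem_union.1 hu).resolve_left hu'
  unfold terminalCut at h1
  rw [Finset.inter_comm C X]
  refine ⟨?_, by omega⟩
  by_contra h5
  have h6 : α v ≤ ∑ u ∈ C \ X, α u :=
    Finset.single_le_sum (f := α) (fun _ _ => Nat.zero_le _) (Finset.mem_sdiff.2 ⟨hv, h5⟩)
  omega

/-- Capacity `τ + 1` at the vertices of `R` on which `g` takes the value `s`. -/
def terminalCapacity (τ : ℕ) (R : Finset V) (g : V → Bool) (s : Bool) (v : V) : ℕ :=
  if v ∈ R ∧ g v = s then τ + 1 else 0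

theorem sum_terminalCapacity_le (τ : ℕ) (R : Finset V) (g : V → Bool) (s : Bool) :
    ∑ v, terminalCapacity τ R g s v ≤ (τ + 1) * R.card := by
  simp only [terminalCapacity]
  rw [← Finset.sum_filter, Finset.sum_const, smul_eq_mul, mul_comm]
  refine Nat.mul_le_mul_left _ (Finset.card_le_card fun v hv => ?_)
  exact (Finset.mem_filter.1 hv).2.1

theorem cutSize_inter_side_le {G : SimpleGraph V} {τ : ℕ} {R X C : Finset V} {g : V → Bool} {v : V}
    (hX : ∀ Y, terminalCut G (terminalCapacity τ R g true) (terminalCapacity τ R g false) X ≤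
      terminalCut G (terminalCapacity τ R g true) (terminalCapacity τ R g false) Y)
    (hC : C ∩ R = {v}) (hτ : cutSize G C ≤ τ) :
    v ∈ C.filter (fun u => decide (u ∈ X) = g v) ∧
      cutSize G (C.filter fun u => decide (u ∈ X) = g v) ≤ cutSize G C := by
  have hv : v ∈ C ∩ R := hC ▸ Finset.mem_singleton_self v
  obtain ⟨hvC, hvR⟩ := Finset.mem_inter.1 hv
  have hone : ∀ u ∈ C, u ∈ R → u = v := fun u h1 h2 =>
    Finset.mem_singleton.1 (hC ▸ Finset.mem_inter.2 ⟨h1, h2⟩)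
  cases hg : g v
  -- A terminal on the sink side: complement the cut and exchange source and sink.
  · have := cutSize_inter_le_of_minCut (α := terminalCapacity τ R g false)
      (β := terminalCapacity τ R g true) (X := Xᶜ) (G := G)
      (fun Y => by rw [terminalCut_compl, ← terminalCut_compl _ _ _ Y]; exact hX _) hvC
      (by rw [terminalCapacity, if_pos ⟨hvR, hg⟩]; omega)
      (fun u hu => if_neg fun h => by rw [hone u hu h.1, hg] at h; simp at h)
    have h1 : (C.filter fun u => decide (u ∈ X) = false) = C ∩ Xᶜ := by ext u; simp
    rw [h1]
    exact ⟨Finset.mem_inter.2 ⟨hvC, this.1⟩, this.2⟩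
  · have := cutSize_inter_le_of_minCut hX hvC
      (by rw [terminalCapacity, if_pos ⟨hvR, hg⟩]; omega)
      (fun u hu => if_neg fun h => by rw [hone u hu h.1, hg] at h; simp at h)
    have h1 : (C.filter fun u => decide (u ∈ X) = true) = C ∩ X := by ext u; simp
    rw [h1]
    exact ⟨Finset.mem_inter.2 ⟨hvC, this.1⟩, this.2⟩

/-- Intersecting with one side of each minimum cut in turn never increases the cut and always keeps
v. -/
theorem exists_isolatingCut_in_sides {G : SimpleGraph V} {τ : ℕ} {R : Finset V} {ι : Type*}
    [Fintype ι] {code : V → ι → Bool} {X : ι → Finset V}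
    (hX : ∀ i Y, terminalCut G (terminalCapacity τ R (code · i) true)
        (terminalCapacity τ R (code · i) false) (X i) ≤
      terminalCut G (terminalCapacity τ R (code · i) true)
        (terminalCapacity τ R (code · i) false) Y)
    {C : Finset V} {v : V} (hC : C ∩ R = {v}) (hτ : cutSize G C ≤ τ) :
    ∃ C' ⊆ C, C' ∩ R = {v} ∧ cutSize G C' ≤ τ ∧ ∀ u ∈ C', (fun i => decide (u ∈ X i)) = code v := by
  classical
  suffices h : ∀ s : Finset ι, ∃ C' ⊆ C, C' ∩ R = {v} ∧ cutSize G C' ≤ τ ∧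
      ∀ u ∈ C', ∀ i ∈ s, decide (u ∈ X i) = code v i by
    obtain ⟨C', h1, h2, h3, h4⟩ := h Finset.univ
    exact ⟨C', h1, h2, h3, fun u hu => funext fun i => h4 u hu i (Finset.mem_univ i)⟩
  intro s
  induction s using Finset.induction_on with
  | empty => exact ⟨C, subset_rfl, hC, hτ, by simp⟩
  | insert i s _ ih =>
    obtain ⟨C', h1, h2, h3, h4⟩ := ih
    obtain ⟨h5, h6⟩ := cutSize_inter_side_le (hX i) h2 h3
    refine ⟨_, (Finset.filter_subset _ _).trans h1, ?_, h6.trans h3, fun u hu j hj => ?_⟩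
    · have hv : v ∈ C' ∩ R := h2 ▸ Finset.mem_singleton_self v
      refine Finset.Subset.antisymm ?_ (Finset.singleton_subset_iff.2
        (Finset.mem_inter.2 ⟨h5, (Finset.mem_inter.1 hv).2⟩))
      rw [← h2]
      exact Finset.inter_subset_inter_right (Finset.filter_subset _ _)
    · obtain ⟨hu1, hu2⟩ := Finset.mem_filter.1 hu
      rcases Finset.mem_insert.1 hj with rfl | hj
      · exact hu2
      · exact h4 u hu1 j hj

open Classical in
/-- The number of edges from `u` to vertices with another `c`-value. -/
noncomputable def outDegree (c : V → κ) (G : SimpleGraph V) (u : V) : ℕ :=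
  ((Finset.univ.filter fun w => c u ≠ c w).filter (G.Adj u)).card

/-- An edge leaving the cell leaves Z as well, so as sink capacity the out-degree accounts for all
edges missing from `cellGraph`. -/
theorem cutSize_cellGraph_add (c : V → κ) (G : SimpleGraph V) {k : κ} {Z : Finset V}
    (hZ : ∀ u ∈ Z, c u = k) :
    cutSize (cellGraph c G) Z + ∑ u ∈ Z, outDegree c G u = cutSize G Z := by
  classical
  have h1 : ∑ u ∈ Z, outDegree c G u = ∑ u, ∑ w, if u ∈ Z ∧ c u ≠ c w ∧ G.Adj u w then 1 else 0 := by
    rw [← Finset.univ_inter Z, ← Finset.filter_mem_eq_inter, Finset.sum_filter]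
    refine Finset.sum_congr rfl fun u _ => ?_
    unfold outDegree
    rw [Finset.filter_filter, Finset.card_filter]
    by_cases hu : u ∈ Z <;> simp [hu]
  rw [h1]
  simp only [cutSize_eq_sum_univ, ← Finset.sum_add_distrib]
  refine Finset.sum_congr rfl fun u _ => Finset.sum_congr rfl fun w _ => ?_
  by_cases hu : u ∈ Z
  · by_cases hw : c u = c w
    · simp [cellGraph, hu, hw]
    · have : w ∉ Z := fun h => hw ((hZ u hu).trans (hZ w h).symm)
      simp [cellGraph, hu, hw, this]
  · simp [hu]

/-- No edge of `cellGraph` leaves a union of cells, so one global minimum cut is minimum in each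
cell separately. -/
theorem terminalCut_eq_add (c : V → κ) (G : SimpleGraph V) (α β : V → ℕ) {U : Finset V}
    (hU : ∀ u w, c u = c w → (u ∈ U ↔ w ∈ U)) (X : Finset V) :
    terminalCut (cellGraph c G) α β X =
      (cutSize (cellGraph c G) (X ∩ U) + ∑ v ∈ U \ X, α v + ∑ v ∈ X ∩ U, β v) +
      (cutSize (cellGraph c G) (X \ U) + ∑ v ∈ Uᶜ \ X, α v + ∑ v ∈ X \ U, β v) := by
  classical
  have h1 : cutSize (cellGraph c G) X =
      cutSize (cellGraph c G) (X ∩ U) + cutSize (cellGraph c G) (X \ U) := by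
    simp only [cutSize_eq_sum_univ, ← Finset.sum_add_distrib]
    refine Finset.sum_congr rfl fun u _ => Finset.sum_congr rfl fun w _ => ?_
    by_cases h : (cellGraph c G).Adj u w
    · have := hU u w h.2
      by_cases hu : u ∈ U <;> simp_all
    · simp [h]
  have h2 : ∑ v ∈ Xᶜ, α v = ∑ v ∈ U \ X, α v + ∑ v ∈ Uᶜ \ X, α v := by
    rw [← Finset.sum_union (Finset.disjoint_left.2 fun u hu hu' => by simp_all)]
    congr 1; ext u; simp; tauto
  have h3 : ∑ v ∈ X, β v = ∑ v ∈ X ∩ U, β v + ∑ v ∈ X \ U, β v :=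
    (Finset.sum_inter_add_sum_sdiff X U β).symm
  unfold terminalCut
  omega

theorem cutSize_cell_le_of_minCut {c : V → κ} {G : SimpleGraph V} {α : V → ℕ} {X C : Finset V} {k : κ}
    (hX : ∀ Y, terminalCut (cellGraph c G) α (outDegree c G) X ≤
      terminalCut (cellGraph c G) α (outDegree c G) Y)
    (hC : ∀ u ∈ C, c u = k) {U : Finset V} (hU : ∀ u, u ∈ U ↔ c u = k) :
    cutSize G (X ∩ U) + ∑ u ∈ U \ X, α u ≤ cutSize G C + ∑ u ∈ U \ C, α u := by
  have hU' : ∀ u w, c u = c w → (u ∈ U ↔ w ∈ U) := fun u w h => by rw [hU, hU, h]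
  have h1 := hX ((X \ U) ∪ C)
  rw [terminalCut_eq_add c G _ _ hU', terminalCut_eq_add c G _ _ hU'] at h1
  have hCU : C ⊆ U := fun u hu => (hU u).2 (hC u hu)
  have e1 : ((X \ U) ∪ C) ∩ U = C := by
    ext u; have := @hCU u; simp; tauto
  have e2 : ((X \ U) ∪ C) \ U = X \ U := by
    ext u; have := @hCU u; simp; tauto
  have e3 : U \ ((X \ U) ∪ C) = U \ C := by
    ext u; simp; tauto
  have e4 : Uᶜ \ ((X \ U) ∪ C) = Uᶜ \ X := by
    ext u; have := @hCU u; simp; tauto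
  rw [e1, e2, e3, e4] at h1
  have h2 := cutSize_cellGraph_add c G hC
  have h3 := cutSize_cellGraph_add c G (Z := X ∩ U) (k := k)
    fun u hu => (hU u).1 (Finset.mem_inter.1 hu).2
  omega

/-- The cells of the sign vectors `sign`; terminals whose sign vector is not their code are put
into a cell of their own. -/
def isolatingCell {ι : Type*} (R : Finset V) (code sign : V → ι → Bool) [DecidableEq (ι → Bool)]
    (u : V) : Option (ι → Bool) :=
  if u ∈ R ∧ sign u ≠ code u then none else some (sign u)

/-- With misplaced terminals moved to `none`, the cell of a code contains at most one terminal. -/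
theorem isolatingCell_eq_some_code {ι : Type*} [DecidableEq (ι → Bool)] {R : Finset V}
    {code sign : V → ι → Bool} (hcode : Function.Injective code) {u v : V} (hu : u ∈ R)
    (h : isolatingCell R code sign u = some (code v)) : u = v := by
  unfold isolatingCell at h
  split_ifs at h with h1
  have : sign u = code u := by simpa [hu] using h1
  exact hcode (this ▸ Option.some.inj h)

/-- Isolating cuts: the outputs include a small cut whenever some small cut isolates a vertex of
`R`. -/
theorem solvable_isolatingCuts {ι : Type*} [Fintype ι] {code : V → ι → Bool}
    (hcode : Function.Injective code) (τ : ℕ) (R : Finset V) {D F : ℕ} (hD : 0 < D)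
    (hn : Fintype.card V ^ 2 ≤ D ^ 3) (hF : (τ + 1) * R.card ≤ F) {𝒢 : Set (SimpleGraph V)} :
    Solvable 𝒢 ((Fintype.card ι + 1) * minCutCost V D F + Fintype.card V * 3)
      fun G (Z : V → Finset V) => ∀ C v, C ∩ R = {v} → cutSize G C ≤ τ → (R \ C).Nonempty →
        IsCut (Z v) ∧ cutSize G (Z v) ≤ τ := by
  classical
  rw [Nat.succ_mul, add_assoc]
  refine (Solvable.pi (ι := ι) fun i => solvable_minCut (fun _ => ())
    (terminalCapacity τ R (code · i) true) (terminalCapacity τ R (code · i) false) hD hn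
    ((sum_terminalCapacity_le _ _ _ _).trans hF)).bind fun X => ?_
  set c := isolatingCell R code fun u i => decide (u ∈ X i) with hc
  rw [Nat.add_comm]
  refine (Solvable.pi (ι := V) fun u => solvable_degreeInto u
    (Finset.univ.filter fun w => c u ≠ c w) (by simp)).bind fun β => ?_
  refine (solvable_minCut c (terminalCapacity τ R (fun u => decide (c u = some (code u))) true) β hD hn
    ((sum_terminalCapacity_le _ _ _ _).trans hF)).map
    (fun Y v => Y ∩ Finset.univ.filter fun u => c u = some (code v)) ?_
  rintro G ⟨⟨-, hX⟩, hβ⟩ Y hY C v hC hτ hR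
  obtain rfl : β = outDegree c G := funext fun u => (hβ u).trans (by unfold outDegree; congr)
  simp only [cellGraph_const] at hX
  obtain ⟨C', h1, h2, h3, h4⟩ := exists_isolatingCut_in_sides hX hC hτ
  have hv : v ∈ C' ∩ R := h2 ▸ Finset.mem_singleton_self v
  obtain ⟨hvC, hvR⟩ := Finset.mem_inter.1 hv
  have hcell : ∀ u ∈ C', c u = some (code v) := fun u hu => by
    rw [hc, isolatingCell, if_neg, h4 u hu]
    rintro ⟨h5, h6⟩
    obtain rfl : u = v := Finset.mem_singleton.1 (h2 ▸ Finset.mem_inter.2 ⟨hu, h5⟩)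
    exact h6 (h4 u hu)
  set U := Finset.univ.filter fun u => c u = some (code v) with hU
  have hUR : ∀ u ∈ U, u ∈ R → u = v := fun u hu huR =>
    isolatingCell_eq_some_code hcode huR (Finset.mem_filter.1 hu).2
  have h5 := cutSize_cell_le_of_minCut hY hcell (U := U) (by simp [hU])
  have h6 : ∑ u ∈ U \ C', terminalCapacity τ R (fun u => decide (c u = some (code u))) true u = 0 := by
    refine Finset.sum_eq_zero fun u hu => if_neg fun h => ?_
    obtain ⟨hu1, hu2⟩ := Finset.mem_sdiff.1 hu
    exact hu2 (hUR u hu1 h.1 ▸ hvC)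
  have hvU : v ∈ U := Finset.mem_filter.2 ⟨Finset.mem_univ v, hcell v hvC⟩
  -- Leaving v out would cost τ + 1, more than the isolating cut C' inside the cell.
  have hvY : v ∈ Y := by
    by_contra h7
    have h8 := Finset.single_le_sum
      (f := terminalCapacity τ R (fun u => decide (c u = some (code u))) true)
      (fun _ _ => Nat.zero_le _) (Finset.mem_sdiff.2 ⟨hvU, h7⟩)
    rw [terminalCapacity, if_pos ⟨hvR, by simpa using hcell v hvC⟩] at h8
    omega
  refine ⟨⟨⟨v, Finset.mem_inter.2 ⟨hvY, hvU⟩⟩, ?_⟩,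
    show cutSize G (Y ∩ U) ≤ τ by omega⟩
  obtain ⟨w, hw⟩ := hR
  obtain ⟨hwR, hwC⟩ := Finset.mem_sdiff.1 hw
  refine ⟨w, Finset.mem_compl.2 fun h => hwC ?_⟩
  rw [hUR w (Finset.mem_inter.1 h).2 hwR]
  exact h1 hvC

end IsolatingCuts

/-! ### Deterministic isolation by polynomial hashing -/

section Hashing

variable {V : Type*} {p d : ℕ}

/-- The polynomial over `ZMod p` whose coefficients are the bits of `v`, evaluated at `e`. -/
def bitHash (code : V → Fin d → Bool) (e : ZMod p) (v : V) : ZMod p :=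
  ∑ i, (if code v i then 1 else 0) * e ^ (i : ℕ)

/-- Collisions are roots of the difference polynomial, which is nonzero since distinct bits stay
distinct modulo p. -/
theorem card_bitHash_collision_le [Fact p.Prime] {code : V → Fin d → Bool} {x y : V}
    (h : code x ≠ code y) :
    (Finset.univ.filter fun e : ZMod p => bitHash code e x = bitHash code e y).card ≤ d := by
  classical
  obtain ⟨i₀, hi₀⟩ := Function.ne_iff.1 h
  set coef : Fin d → ZMod p := fun i =>
    (if code x i then 1 else 0) - (if code y i then 1 else 0) with hcoef
  set Q : Polynomial (ZMod p) := ∑ i : Fin d, Polynomial.C (coef i) * Polynomial.X ^ (i : ℕ) with hQ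
  have hne : Q ≠ 0 := by
    intro h0
    have h1 : Q.coeff i₀ = coef i₀ := by
      rw [hQ, Polynomial.finsetSum_coeff, Finset.sum_eq_single i₀]
      · simp
      · intro j _ hj
        rw [Polynomial.coeff_C_mul_X_pow, if_neg fun h => hj (Fin.ext h.symm)]
      · simp
    rw [h0, Polynomial.coeff_zero] at h1
    simp only [hcoef] at h1
    cases hx : code x i₀ <;> cases hy : code y i₀ <;> simp [hx, hy] at h1 hi₀
  have hdeg : Q.natDegree ≤ d := by
    refine Polynomial.natDegree_sum_le_of_forall_le _ _ fun i _ => ?_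
    exact (Polynomial.natDegree_C_mul_X_pow_le _ _).trans i.2.le
  refine le_trans (Finset.card_le_card fun e he => ?_)
    ((Multiset.toFinset_card_le Q.roots).trans ((Polynomial.card_roots' Q).trans hdeg))
  have he' := (Finset.mem_filter.1 he).2
  rw [Multiset.mem_toFinset, Polynomial.mem_roots hne, Polynomial.IsRoot, hQ,
    Polynomial.eval_finsetSum]
  simp only [bitHash] at he'
  simp only [hcoef, Polynomial.eval_mul, Polynomial.eval_C, Polynomial.eval_pow,
    Polynomial.eval_X, sub_mul, Finset.sum_sub_distrib, he', sub_self]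

theorem exists_bitHash_ne [Fact p.Prime] {code : V → Fin d → Bool}
    (hcode : Function.Injective code) (S : Finset (V × V)) (hS : ∀ z ∈ S, z.1 ≠ z.2)
    (hp : S.card * d < p) : ∃ e : ZMod p, ∀ z ∈ S, bitHash code e z.1 ≠ bitHash code e z.2 := by
  classical
  by_contra! h
  have h1 : (Finset.univ : Finset (ZMod p)) ⊆ S.biUnion fun z =>
      Finset.univ.filter fun e => bitHash code e z.1 = bitHash code e z.2 := fun e _ => by
    obtain ⟨z, hz, hze⟩ := h e
    exact Finset.mem_biUnion.2 ⟨z, hz, Finset.mem_filter.2 ⟨Finset.mem_univ e, hze⟩⟩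
  have h2 := (Finset.card_le_card h1).trans (Finset.card_biUnion_le_card_mul S _ d fun z hz =>
    card_bitHash_collision_le (hcode.ne (hS z hz)))
  rw [Finset.card_univ, ZMod.card] at h2
  omega

/-- The vertices of `R` whose hash value is one of two given values. -/
def hashClass [DecidableEq V] (code : V → Fin d → Bool) (R : Finset V)
    (j : ZMod p × ZMod p × ZMod p) : Finset V :=
  R.filter fun v => bitHash code j.1 v = j.2.1 ∨ bitHash code j.1 v = j.2.2

/-- Fix t in C ∩ R and w in R \ C. Fewer than p points are bad for separating both from the rest of
C ∩ R; keep the hash values of t and w at a good point. -/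
theorem exists_hashClass_isolating [DecidableEq V] [Fact p.Prime] {code : V → Fin d → Bool}
    (hcode : Function.Injective code) {R C : Finset V} (h1 : (C ∩ R).Nonempty)
    (h2 : (R \ C).Nonempty) (hp : 2 * (C ∩ R).card * d < p) :
    ∃ (j : ZMod p × ZMod p × ZMod p) (v : V), C ∩ hashClass code R j = {v} ∧
      (hashClass code R j \ C).Nonempty := by
  obtain ⟨t, ht⟩ := h1
  obtain ⟨w, hw⟩ := h2
  obtain ⟨htC, htR⟩ := Finset.mem_inter.1 ht
  obtain ⟨hwR, hwC⟩ := Finset.mem_sdiff.1 hw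
  set S := ((C ∩ R).erase t).image (fun u => (t, u)) ∪ (C ∩ R).image fun u => (w, u) with hS
  have hne : ∀ z ∈ S, z.1 ≠ z.2 := by
    intro z hz
    rcases Finset.mem_union.1 hz with hz | hz
    · obtain ⟨u, hu, rfl⟩ := Finset.mem_image.1 hz
      exact (Finset.ne_of_mem_erase hu).symm
    · obtain ⟨u, hu, rfl⟩ := Finset.mem_image.1 hz
      rintro (rfl : w = u)
      exact hwC (Finset.mem_inter.1 hu).1
  have hcard : S.card ≤ 2 * (C ∩ R).card := by
    refine (Finset.card_union_le _ _).trans ?_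
    rw [two_mul]
    exact add_le_add (Finset.card_image_le.trans Finset.card_erase_le) Finset.card_image_le
  obtain ⟨e, he⟩ := exists_bitHash_ne (p := p) hcode S hne
    (lt_of_le_of_lt (Nat.mul_le_mul_right d hcard) hp)
  refine ⟨(e, bitHash code e t, bitHash code e w), t, ?_,
    ⟨w, Finset.mem_sdiff.2 ⟨Finset.mem_filter.2 ⟨hwR, .inr rfl⟩, hwC⟩⟩⟩
  refine Finset.Subset.antisymm (fun u hu => ?_) (Finset.singleton_subset_iff.2
    (Finset.mem_inter.2 ⟨htC, Finset.mem_filter.2 ⟨htR, .inl rfl⟩⟩))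
  obtain ⟨huC, hu⟩ := Finset.mem_inter.1 hu
  obtain ⟨huR, hu⟩ := Finset.mem_filter.1 hu
  rw [Finset.mem_singleton]
  by_contra hut
  have huCR := Finset.mem_inter.2 ⟨huC, huR⟩
  rcases hu with hu | hu
  · exact he (t, u) (Finset.mem_union_left _ (Finset.mem_image_of_mem _
      (Finset.mem_erase.2 ⟨hut, huCR⟩))) hu.symm
  · exact he (w, u) (Finset.mem_union_right _ (Finset.mem_image_of_mem _ huCR)) hu.symm

end Hashing

/-! ### Assembly and cost estimates -/

section Main

variable {V : Type*} [Fintype V] [DecidableEq V]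

theorem exists_injective_code (V : Type*) [Fintype V] :
    ∃ code : V → Fin (Nat.clog 2 (Fintype.card V)) → Bool, Function.Injective code := by
  have : Nonempty (V ↪ (Fin (Nat.clog 2 (Fintype.card V)) → Bool)) := by
    rw [Function.Embedding.nonempty_iff_card_le]
    simpa using Nat.le_pow_clog one_lt_two (Fintype.card V)
  obtain ⟨f⟩ := this
  exact ⟨f, f.injective⟩

theorem solvable_unbalancedCut (τ : ℕ) (R : Finset V) {D F s p : ℕ} [Fact p.Prime] (hD : 0 < D)
    (hn : Fintype.card V ^ 2 ≤ D ^ 3) (hF : (τ + 1) * R.card ≤ F)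
    (hp : 2 * s * Nat.clog 2 (Fintype.card V) < p) :
    Solvable Set.univ (p ^ 3 * ((Nat.clog 2 (Fintype.card V) + 1) * minCutCost V D F +
        Fintype.card V * 3) + p ^ 3 * Fintype.card V)
      fun G (X : Finset V) => IsSeparated G τ R →
        (∃ C, IsCut C ∧ cutSize G C ≤ τ ∧ min (C ∩ R).card (Cᶜ ∩ R).card ≤ s) →
        IsCut X ∧ cutSize G X ≤ τ := by
  obtain ⟨code, hcode⟩ := exists_injective_code V
  have hcard : Fintype.card (ZMod p × ZMod p × ZMod p) = p ^ 3 := by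
    simp only [Fintype.card_prod, ZMod.card]; ring
  have h1 := Solvable.pi (𝒢 := Set.univ) fun j : ZMod p × ZMod p × ZMod p =>
    solvable_isolatingCuts hcode τ (hashClass code R j) hD hn
      ((Nat.mul_le_mul_left _ (Finset.card_le_card (Finset.filter_subset _ _))).trans hF)
  rw [Fintype.card_fin, hcard] at h1
  refine h1.bind fun Z => ?_
  have h2 := solvable_select (𝒢 := {G | G ∈ Set.univ ∧ ∀ (j : ZMod p × ZMod p × ZMod p) (C : Finset V) v,
    C ∩ hashClass code R j = {v} → cutSize G C ≤ τ → (hashClass code R j \ C).Nonempty →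
        IsCut (Z j v) ∧ cutSize G (Z j v) ≤ τ})
    (fun jv : (ZMod p × ZMod p × ZMod p) × V => Z jv.1 jv.2) IsCut τ
  rw [Fintype.card_prod, hcard] at h2
  refine h2.mono subset_rfl le_rfl ?_
  rintro G ⟨-, hZ⟩ X hX hsep ⟨C, hC, hCτ, hCs⟩
  obtain ⟨C, hC, hCτ, hCs⟩ : ∃ C : Finset V, IsCut C ∧ cutSize G C ≤ τ ∧ (C ∩ R).card ≤ s := by
    rcases min_le_iff.1 hCs with h | h
    · exact ⟨C, hC, hCτ, h⟩
    · exact ⟨Cᶜ, ⟨hC.2, by rw [compl_compl]; exact hC.1⟩, (cutSize_compl G C).trans_le hCτ, h⟩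
  obtain ⟨h3, h4⟩ := hsep C hC hCτ
  obtain ⟨j, v, h5, h6⟩ := exists_hashClass_isolating (p := p) hcode h3 h4
    (lt_of_le_of_lt (by gcongr) hp)
  exact hX ⟨(j, v), hZ j C v h5 hCτ h6⟩

theorem clog_two_le_three_mul_log {n : ℕ} (hn : 2 ≤ n) : (Nat.clog 2 n : ℝ) ≤ 3 * Real.log n := by
  have h1 := Real.log_two_gt_d9
  have hn' : (2 : ℝ) ≤ n := by exact_mod_cast hn
  have h2 : Real.log 2 ≤ Real.log n := Real.log_le_log (by norm_num) hn'
  have h3 : 2 ^ (Nat.clog 2 n - 1) < n := Nat.pow_pred_clog_lt_self one_lt_two (by omega)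
  have h4 : ((Nat.clog 2 n - 1 : ℕ) : ℝ) * Real.log 2 ≤ Real.log n := by
    rw [← Real.log_pow]
    exact Real.log_le_log (by positivity) (by exact_mod_cast h3.le)
  have h5 : (Nat.clog 2 n : ℝ) ≤ ((Nat.clog 2 n - 1 : ℕ) : ℝ) + 1 := by
    exact_mod_cast (by omega : Nat.clog 2 n ≤ Nat.clog 2 n - 1 + 1)
  have h6 : (0 : ℝ) ≤ ((Nat.clog 2 n - 1 : ℕ) : ℝ) := Nat.cast_nonneg _
  nlinarith

theorem minCutCost_le {D F a : ℕ} {c N M : ℝ} (hc : 0 ≤ c) (hN : 1 ≤ N) (hM : 1 ≤ M)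
    (hD : (D : ℝ) ≤ 2 * N) (hF : (F : ℝ) ≤ (c + 1) * Fintype.card V * M ^ a)
    (hd : (Nat.clog 2 (Fintype.card V) : ℝ) ≤ M) :
    (minCutCost V D F : ℝ) ≤ (102 + 18 * c) * (Fintype.card V * N) * M ^ (a + 1) := by
  unfold minCutCost findCost
  push_cast
  set n : ℝ := (Fintype.card V : ℝ) with hn
  have hn0 : 0 ≤ n := Nat.cast_nonneg _
  have h1 : (1 : ℝ) ≤ M ^ a := one_le_pow₀ hM
  have h2 : 3 * ((Nat.clog 2 (Fintype.card V) : ℝ) + 1) ≤ 6 * M := by linarith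
  have h3 : (D : ℝ) + 1 ≤ 3 * N := by linarith
  have h4 : 2 * (D : ℝ) + 1 ≤ 5 * N := by linarith
  calc _ ≤ (2 * (n * (2 * N)) + (3 * N) * ((c + 1) * n * M ^ a)) * (6 * M) +
        (5 * N) * (2 * n * (6 * M)) := by gcongr
    _ = (n * N * M) * (84 * 1 + 18 * (c + 1) * M ^ a) := by ring
    _ ≤ (n * N * M) * (84 * M ^ a + 18 * (c + 1) * M ^ a) := by gcongr
    _ = _ := by ring

theorem total_cost_le {n N M A B x p d : ℝ} {i j : ℕ} (hn : 0 ≤ n) (hN : 1 ≤ N) (hM : 1 ≤ M)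
    (hx0 : 0 ≤ x) (hp0 : 0 ≤ p) (hd : d ≤ M) (hd0 : 0 ≤ d)
    (hp : p ≤ A * M ^ i) (hx : x ≤ B * (n * N) * M ^ j) :
    p ^ 3 * ((d + 1) * x + n * 3) + p ^ 3 * n ≤
      A ^ 3 * (2 * B + 4) * (n * N) * M ^ (3 * i + j + 1) := by
  have h1 : (1 : ℝ) ≤ M ^ (j + 1) := one_le_pow₀ hM
  have h2 : (d + 1) ≤ 2 * M := by linarith
  have h3 : 0 ≤ A * M ^ i := hp0.trans hp
  calc _ = p ^ 3 * ((d + 1) * x + 4 * (n * 1 * 1)) := by ring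
    _ ≤ (A * M ^ i) ^ 3 * ((2 * M) * (B * (n * N) * M ^ j) + 4 * (n * N * M ^ (j + 1))) := by
      gcongr
    _ = _ := by ring

end Main

theorem mainTheorem7 (c₁ c₂ : ℝ) (hc₁ : 0 < c₁) (hc₂ : 0 < c₂) (a b : ℕ) :
    ∃ (K : ℝ) (k : ℕ), ∀ (V : Type*) [Fintype V] [DecidableEq V] (τ : ℕ) (R : Finset V),
      (R.card : ℝ) * τ ≤ c₁ * Fintype.card V * Real.log (Fintype.card V) ^ a →
      ∃ A : CutQueryAlgorithm V (Finset V),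
        (∀ G : SimpleGraph V,
          (A.numQueries (cutSize G) : ℝ) ≤
            K * (Fintype.card V : ℝ) ^ (5 / 3 : ℝ) * Real.log (Fintype.card V) ^ k) ∧
        ∀ G : SimpleGraph V, IsSeparated G τ R →
          (∃ (φ : ℝ) (C : Finset V), c₂ * (1 / Real.log (Fintype.card V)) ^ b ≤ φ ∧
            IsCut C ∧ cutSize G C ≤ τ ∧ IsUnbalanced φ R C) →
          IsCut (A.run (cutSize G)) ∧ cutSize G (A.run (cutSize G)) ≤ τ := by
  set A₁ : ℝ := (1 / c₂) ^ 3 + 1 / c₂ with hA₁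
  set A₂ : ℝ := 4 * A₁ + 2 with hA₂
  set k : ℕ := 3 * (3 * b + 1) + (a + 1) + 1 with hk
  refine ⟨A₂ ^ 3 * (2 * (102 + 18 * c₁) + 4) * 3 ^ k, k, ?_⟩
  intro V _ _ τ R hR
  have hA₁0 : 0 ≤ A₁ := by positivity
  rcases Nat.lt_or_ge (Fintype.card V) 2 with hcard | hcard
  · refine ⟨.output ∅, fun G => ?_, ?_⟩
    · have : 0 ≤ Real.log (Fintype.card V : ℝ) := Real.log_natCast_nonneg _
      simp only [CutQueryAlgorithm.numQueries, Nat.cast_zero]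
      positivity
    · rintro G - ⟨φ, C, -, ⟨⟨x, hx⟩, ⟨y, hy⟩⟩, -⟩
      have := Fintype.card_le_one_iff.1 (Nat.lt_succ_iff.1 hcard) x y
      exact absurd (this ▸ hx) (Finset.mem_compl.1 hy)
  set n := Fintype.card V with hn
  set l : ℝ := Real.log n with hl
  have hn1 : (1 : ℝ) ≤ n := by exact_mod_cast (by omega : 1 ≤ n)
  have hd : (Nat.clog 2 n : ℝ) ≤ 3 * l := clog_two_le_three_mul_log hcard
  have hM : 1 ≤ 3 * l := le_trans (by exact_mod_cast Nat.clog_pos one_lt_two hcard) hd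
  have hl0 : 0 < l := by linarith
  have hlM : l ≤ 3 * l := by linarith
  set y : ℝ := l ^ b / c₂ with hy
  have hy0 : 0 ≤ y := by positivity
  -- As 1/φ ≤ y for every admissible φ, this s serves all of them, so the tree need not know φ.
  set s : ℕ := ⌊y ^ 3 + y⌋₊ with hs
  have hsle : (s : ℝ) ≤ A₁ * (3 * l) ^ (3 * b) := by
    refine (Nat.floor_le (by positivity)).trans ?_
    have h1 : y ≤ (3 * l) ^ b / c₂ := by rw [hy]; gcongr
    have h2 : (3 * l) ^ b ≤ (3 * l) ^ (3 * b) := pow_le_pow_right₀ hM (by omega)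
    calc y ^ 3 + y ≤ ((3 * l) ^ b / c₂) ^ 3 + (3 * l) ^ b / c₂ := by gcongr
      _ ≤ ((3 * l) ^ b / c₂) ^ 3 + (3 * l) ^ (3 * b) / c₂ := by gcongr
      _ = _ := by rw [hA₁, pow_mul']; ring
  obtain ⟨p, hp, hp1, hp2⟩ := Nat.exists_prime_lt_and_le_two_mul (2 * s * Nat.clog 2 n + 1)
    (by omega)
  have : Fact p.Prime := ⟨hp⟩
  have hple : (p : ℝ) ≤ A₂ * (3 * l) ^ (3 * b + 1) := by
    have h1 : (p : ℝ) ≤ 2 * (2 * s * Nat.clog 2 n + 1) := by exact_mod_cast hp2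
    refine h1.trans ?_
    calc 2 * (2 * (s : ℝ) * Nat.clog 2 n + 1)
        ≤ 2 * (2 * (A₁ * (3 * l) ^ (3 * b)) * (3 * l) + (3 * l) ^ (3 * b + 1)) := by
          gcongr
          exact one_le_pow₀ hM
      _ = _ := by rw [hA₂]; ring
  set N : ℝ := (n : ℝ) ^ (2 / 3 : ℝ) with hN
  have hN1 : 1 ≤ N := Real.one_le_rpow hn1 (by norm_num)
  have hN3 : N ^ 3 = (n : ℝ) ^ 2 := by
    rw [hN, ← Real.rpow_natCast, ← Real.rpow_mul (by positivity), ← Real.rpow_natCast]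
    norm_num
  set D : ℕ := ⌈N⌉₊ with hD
  have hD0 : 0 < D := Nat.ceil_pos.2 (by linarith)
  have hDle : (D : ℝ) ≤ 2 * N := by
    have := Nat.ceil_lt_add_one (show 0 ≤ N by linarith)
    linarith
  have hDn : n ^ 2 ≤ D ^ 3 := by
    have : (n : ℝ) ^ 2 ≤ (D : ℝ) ^ 3 := by
      rw [← hN3]
      exact pow_le_pow_left₀ (by linarith) (Nat.le_ceil N) 3
    exact_mod_cast this
  -- The extra 1 in c₁ + 1 covers |R| ≤ n, coming from capacities τ + 1 instead of τ.
  have hF : (((τ + 1) * R.card : ℕ) : ℝ) ≤ (c₁ + 1) * n * (3 * l) ^ a := by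
    have h1 : (R.card : ℝ) ≤ n := by exact_mod_cast Finset.card_le_univ R
    push_cast
    calc ((τ : ℝ) + 1) * R.card = R.card * τ + R.card * 1 := by ring
      _ ≤ c₁ * n * (3 * l) ^ a + n * (3 * l) ^ a :=
        add_le_add (hR.trans (by gcongr)) (mul_le_mul h1 (one_le_pow₀ hM) zero_le_one (by positivity))
      _ = _ := by ring
  obtain ⟨A, hA⟩ := solvable_unbalancedCut (V := V) τ R (s := s) (p := p) hD0 hDn le_rfl
    (Nat.lt_of_succ_lt hp1)
  refine ⟨A, fun G => ?_, ?_⟩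
  · refine le_trans (Nat.cast_le.2 (hA G trivial).1) ?_
    have h1 := minCutCost_le (V := V) hc₁.le hN1 hM hDle hF hd
    have h2 := total_cost_le (by positivity : (0 : ℝ) ≤ n) hN1 hM
      (Nat.cast_nonneg _) (Nat.cast_nonneg p) hd (Nat.cast_nonneg _) hple h1
    have h3 : (n : ℝ) * N = (n : ℝ) ^ (5 / 3 : ℝ) := by
      rw [hN, ← Real.rpow_one_add' (by positivity) (by norm_num)]
      norm_num
    rw [h3, mul_pow, ← hk] at h2
    push_cast
    refine h2.trans (le_of_eq ?_)
    ring
  · rintro G hsep ⟨φ, C, hφ, hC, hCτ, hun⟩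
    refine (hA G trivial).2 hsep ⟨C, hC, hCτ, Nat.le_floor (le_trans hun ?_)⟩
    have h1 : 1 / φ ≤ y := by
      have h2 : c₂ * (1 / l) ^ b = 1 / y := by
        rw [hy, one_div_div, one_div, inv_pow, div_eq_mul_inv]
      have hy1 : 0 < y := by positivity
      rw [h2] at hφ
      exact (one_div_le hy1 (lt_of_lt_of_le (by positivity) hφ)).1 hφ
    have h0 : 0 ≤ 1 / φ := by
      have : 0 < c₂ * (1 / l) ^ b := by positivity
      have := this.trans_le hφ
      positivity
    gcongr
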